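/- Let $n\ge 0$ be an integer and let $A,B$ be normal $n\times n$ complex matrices. Let $\|\cdot\|$ be a symmetric (unitarily invariant) norm on the $n\times n$ complex matrices, that is, a norm such that $\|UXV\|=\|X\|$ for every $X$ and all unitary matrices $U,V$. Then, for every real $p$ with $0\le p\le 1$, $$\big\|\,|A+B|^p\,\big\|\le\big\|\,|A|^p+|B|^p\,\big\|.$$ Here $|X|=(X^*X)^{1/2}$ is the positive semidefinite absolute value of $X$, and $|X|^p$ is obtained from $|X|$ by the functional calculus for the function $t\mapsto t^p$ on $[0,\infty)$, where $t^0=1$ for all $t\ge0$ (so $|X|^0=I$). -/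

import Mathlib

open scoped MatrixOrder

/-- A symmetric (unitarily invariant) norm on the complex `n × n` matrices: a norm (that is, a
seminorm over `ℂ` vanishing only at `0`) with `N (U * A * V) = N A` for every matrix `A` and all
unitary matrices `U`, `V`. -/
structure IsSymmetricNorm {n : ℕ} (N : Seminorm ℂ (Matrix (Fin n) (Fin n) ℂ)) : Prop where
  eq_zero_of_map_eq_zero : ∀ A : Matrix (Fin n) (Fin n) ℂ, N A = 0 → A = 0
  map_unitary_mul_mul_unitary : ∀ A U V : Matrix (Fin n) (Fin n) ℂ,
    U ∈ Matrix.unitaryGroup (Fin n) ℂ → V ∈ Matrix.unitaryGroup (Fin n) ℂ →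
      N (U * A * V) = N A

/-! Put a = |A| + e, b = |B| + e, S = a + b and X = A + B, with e > 0. Normality makes the block
matrix with diagonal blocks S, S and off-diagonal blocks Xᴴ, X positive, so the singular values s of
X are weakly log-majorized by the eigenvalues l of S
(`prod_singular_le_prod_of_fromBlocks_posSemidef`). Convexity of exp turns this into weak
majorization of s^p by l^p.

Subadditivity of t^p is then used on diagonals: in a sorted eigenbasis of S, partial sums of l^p are
at most those of the diagonal of a^p + b^p (`PosDef.sum_rpow_le_sum_diag_rpow_add_rpow`), and a^p ≤
|A|^p + e^p, likewise for b. So s^p lies in the convex hull of the signed permutations of a diagonal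
of |A|^p + |B|^p + 2e^p. A symmetric norm is constant on those permutations and does not increase
under pinching, which gives the inequality up to an error vanishing with e. -/

/-! ### Scalar majorization -/

/-- Abel summation: a nonnegative antitone weight preserves nonnegativity of partial sums. -/
theorem sum_mul_nonneg_of_antitone {n : ℕ} (w z : Fin n → ℝ) (hw : Antitone w) (hw0 : ∀ i, 0 ≤ w i)
    (hz : ∀ k (hk : k ≤ n), 0 ≤ ∑ i : Fin k, z (Fin.castLE hk i)) : 0 ≤ ∑ i, w i * z i := by
  induction n with
  | zero => simp
  | succ n ih =>
    have h1 := ih (fun i => w i.castSucc - w (Fin.last n)) (fun i => z i.castSucc)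
      (fun i j hij => by
        have := hw (Fin.castSucc_le_castSucc_iff.2 hij)
        simpa using this)
      (fun i => sub_nonneg.2 (hw (Fin.le_last _)))
      (fun k hk => hz k (hk.trans n.le_succ))
    have h2 := mul_nonneg (hw0 (Fin.last n)) (hz (n + 1) le_rfl)
    rw [Fin.sum_univ_castSucc] at h2 ⊢
    simp only [sub_mul, Finset.sum_sub_distrib, ← Finset.mul_sum] at h1
    simp only [Fin.castLE_rfl, id] at h2
    linarith

theorem sum_mul_le_sum_mul_of_antitone {n : ℕ} (w x y : Fin n → ℝ) (hw : Antitone w)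
    (hw0 : ∀ i, 0 ≤ w i)
    (h : ∀ k (hk : k ≤ n),
      ∑ i : Fin k, x (Fin.castLE hk i) ≤ ∑ i : Fin k, y (Fin.castLE hk i)) :
    ∑ i, w i * x i ≤ ∑ i, w i * y i := by
  have := sum_mul_nonneg_of_antitone w (fun i => y i - x i) hw hw0
    (fun k hk => by simpa [Finset.sum_sub_distrib] using h k hk)
  simpa [mul_sub, Finset.sum_sub_distrib] using this

/-- The tangent line of exp gives y^p - x^p ≥ p x^p (log y - log x). Abel summation with the
antitone weight x^p then uses the partial sums of log y - log x, which are nonnegative by the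
product bounds. -/
theorem sum_rpow_le_sum_rpow_of_prod_le_prod {n : ℕ} (x y : Fin n → ℝ) (hx : Antitone x)
    (hx0 : ∀ i, 0 ≤ x i) (hy : ∀ i, 0 < y i)
    (h : ∀ k (hk : k ≤ n), (∀ i : Fin k, 0 < x (Fin.castLE hk i)) →
      ∏ i : Fin k, x (Fin.castLE hk i) ≤ ∏ i : Fin k, y (Fin.castLE hk i))
    {p : ℝ} (hp : 0 < p) (k : ℕ) (hk : k ≤ n) :
    ∑ i : Fin k, x (Fin.castLE hk i) ^ p ≤ ∑ i : Fin k, y (Fin.castLE hk i) ^ p := by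
  -- Zeros of `x` form a tail because `x` is antitone; setting `z` to 0 there keeps the partial sums
  -- constant.
  let z : Fin n → ℝ := fun i => if 0 < x i then Real.log (y i) - Real.log (x i) else 0
  have hz : ∀ m (hm : m ≤ n), 0 ≤ ∑ i : Fin m, z (Fin.castLE hm i) := by
    intro m
    induction m with
    | zero => intro hm; simp
    | succ m ih =>
      intro hm
      by_cases hpos : 0 < x (Fin.castLE hm (Fin.last m))
      · have hall : ∀ i : Fin (m + 1), 0 < x (Fin.castLE hm i) := fun i =>
          hpos.trans_le (hx (Fin.castLE_le_castLE_iff hm |>.2 (Fin.le_last i)))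
        have h1 := Real.log_le_log (Finset.prod_pos fun i _ => hall i) (h _ hm hall)
        rw [Real.log_prod (fun i _ => (hall i).ne'), Real.log_prod (fun i _ => (hy _).ne')] at h1
        simp only [z, hall, if_true, Finset.sum_sub_distrib]
        linarith
      · rw [Fin.sum_univ_castSucc]
        have : z (Fin.castLE hm (Fin.last m)) = 0 := if_neg hpos
        rw [this, add_zero]
        exact ih (m.le_succ.trans hm)
  have key : ∀ i, p * (x i ^ p * z i) ≤ y i ^ p - x i ^ p := by
    intro i
    by_cases hpos : 0 < x i
    · simp only [z, hpos, if_true]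
      have e1 : y i ^ p = x i ^ p * Real.exp (p * (Real.log (y i) - Real.log (x i))) := by
        rw [Real.rpow_def_of_pos hpos, Real.rpow_def_of_pos (hy i), ← Real.exp_add]
        ring_nf
      have e2 := Real.add_one_le_exp (p * (Real.log (y i) - Real.log (x i)))
      have e3 := mul_le_mul_of_nonneg_left e2 (Real.rpow_nonneg hpos.le p)
      rw [e1]
      linarith
    · have : x i = 0 := le_antisymm (not_lt.1 hpos) (hx0 i)
      simp [z, this, Real.zero_rpow hp.ne', Real.rpow_nonneg (hy i).le]
  have h1 := sum_mul_nonneg_of_antitone (fun i : Fin k => x (Fin.castLE hk i) ^ p)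
    (fun i => z (Fin.castLE hk i))
    (fun i j hij => Real.rpow_le_rpow (hx0 _) (hx (Fin.castLE_le_castLE_iff hk |>.2 hij)) hp.le)
    (fun i => Real.rpow_nonneg (hx0 _) _) (fun m hm => hz m (hm.trans hk))
  have h2 := Finset.sum_le_sum fun (i : Fin k) (_ : i ∈ Finset.univ) => key (Fin.castLE hk i)
  rw [Finset.sum_sub_distrib, ← Finset.mul_sum] at h2
  have h3 := mul_nonneg hp.le h1
  linarith

/-- Weighted sums against an arbitrary weight are dominated after a signed rearrangement. -/
theorem exists_sign_perm_sum_mul_le {n : ℕ} (z x d : Fin n → ℝ) (hx : Antitone x)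
    (hx0 : ∀ i, 0 ≤ x i)
    (h : ∀ k (hk : k ≤ n),
      ∑ i : Fin k, x (Fin.castLE hk i) ≤ ∑ i : Fin k, d (Fin.castLE hk i)) :
    ∃ (e : Fin n → ℤˣ) (σ : Equiv.Perm (Fin n)),
      ∑ i, z i * x i ≤ ∑ i, z i * (((e i : ℤ) : ℝ) * d (σ i)) := by
  -- Sort |z| decreasingly: the rearrangement inequality pairs it with `x`, and Abel summation
  -- replaces `x` by `d`.
  let τ : Equiv.Perm (Fin n) := Tuple.sort fun i => OrderDual.toDual |z i|
  have hτ : Antitone fun i => |z (τ i)| := fun i j hij =>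
    Tuple.monotone_sort (fun i => OrderDual.toDual |z i|) hij
  refine ⟨fun i => if 0 ≤ z i then 1 else -1, τ⁻¹, ?_⟩
  calc ∑ i, z i * x i ≤ ∑ i, |z i| * x i :=
        Finset.sum_le_sum fun i _ => mul_le_mul_of_nonneg_right (le_abs_self _) (hx0 i)
    _ = ∑ i, |z (τ (τ⁻¹ i))| * x i := by simp
    _ ≤ ∑ i, |z (τ i)| * x i :=
        (hτ.monovary hx).sum_comp_perm_mul_le_sum_mul (σ := τ⁻¹)
    _ ≤ ∑ i, |z (τ i)| * d i :=
        sum_mul_le_sum_mul_of_antitone _ _ _ hτ (fun _ => abs_nonneg _) h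
    _ = ∑ i, |z i| * d (τ⁻¹ i) := by
        rw [← Equiv.sum_comp τ (fun i => |z i| * d (τ⁻¹ i))]
        simp
    _ = _ := by
        refine Finset.sum_congr rfl fun i _ => ?_
        by_cases hz : 0 ≤ z i
        · simp [hz, abs_of_nonneg hz]
        · simp [hz, abs_of_neg (not_le.1 hz)]

/-- Weak majorization places a vector in the convex hull of the signed permutations. -/
theorem mem_convexHull_sign_perm {n : ℕ} (x d : Fin n → ℝ) (hx : Antitone x)
    (hx0 : ∀ i, 0 ≤ x i)
    (h : ∀ k (hk : k ≤ n),
      ∑ i : Fin k, x (Fin.castLE hk i) ≤ ∑ i : Fin k, d (Fin.castLE hk i)) :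
    x ∈ convexHull ℝ (Set.range fun q : (Fin n → ℤˣ) × Equiv.Perm (Fin n) =>
      fun i => ((q.1 i : ℤ) : ℝ) * d (q.2 i)) := by
  by_contra hmem
  -- The coefficients of a separating functional would be weights contradicting the signed
  -- rearrangement bound.
  obtain ⟨f, u, hf, hu⟩ := geometric_hahn_banach_closed_point (convex_convexHull ℝ _)
    ((Set.finite_range _).isClosed_convexHull ℝ) hmem
  have hfs : ∀ y : Fin n → ℝ, f y = ∑ i, f (Pi.single i 1) * y i := by
    intro y
    conv_lhs => rw [pi_eq_sum_univ' y]
    simp [mul_comm]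
  obtain ⟨e, σ, hle⟩ := exists_sign_perm_sum_mul_le (fun i => f (Pi.single i 1)) x d hx hx0 h
  have h1 := hf _ (subset_convexHull ℝ _ ⟨(e, σ), rfl⟩)
  rw [hfs] at h1 hu
  linarith

theorem sum_sign_mul_sign {ι : Type*} [Fintype ι] [DecidableEq ι] {i j : ι} (hij : i ≠ j) :
    ∑ e : ι → ℤˣ, (((e i : ℤ) : ℂ) * ((e j : ℤ) : ℂ)) = 0 := by
  -- Flipping the sign at `i` permutes the summands and negates the sum.
  have h := Equiv.sum_comp (Equiv.mulLeft (Pi.mulSingle i (-1) : ι → ℤˣ))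
    (fun e : ι → ℤˣ => (((e i : ℤ) : ℂ) * ((e j : ℤ) : ℂ)))
  simp [Pi.mulSingle_eq_of_ne hij.symm] at h
  linear_combination (-1 / 2 : ℂ) * h

/-! ### Symmetric norms of diagonal matrices -/

namespace IsSymmetricNorm

variable {n : ℕ} {N : Seminorm ℂ (Matrix (Fin n) (Fin n) ℂ)}

theorem diagonal_sign_mem_unitaryGroup (e : Fin n → ℤˣ) :
    Matrix.diagonal (fun i => ((e i : ℤ) : ℂ)) ∈ Matrix.unitaryGroup (Fin n) ℂ := by
  rw [Matrix.mem_unitaryGroup_iff, Matrix.star_eq_conjTranspose, Matrix.diagonal_conjTranspose,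
    Matrix.diagonal_mul_diagonal, ← Matrix.diagonal_one]
  congr 1
  ext i
  rcases Int.units_eq_one_or (e i) with h | h <;> simp [h]

theorem permMatrix_mem_unitaryGroup (σ : Equiv.Perm (Fin n)) :
    σ.permMatrix ℂ ∈ Matrix.unitaryGroup (Fin n) ℂ := by
  rw [Matrix.mem_unitaryGroup_iff, Matrix.star_eq_conjTranspose, Matrix.conjTranspose_permMatrix,
    ← Matrix.permMatrix_mul]
  simp

theorem map_diagonal_sign_perm (hN : IsSymmetricNorm N) (d : Fin n → ℝ) (e : Fin n → ℤˣ)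
    (σ : Equiv.Perm (Fin n)) :
    N (Matrix.diagonal fun i => ((((e i : ℤ) : ℝ) * d (σ i) : ℝ) : ℂ)) =
      N (Matrix.diagonal fun i => (d i : ℂ)) := by
  rw [← hN.map_unitary_mul_mul_unitary (Matrix.diagonal fun i => (d i : ℂ))
    (Matrix.diagonal (fun i => ((e i : ℤ) : ℂ)) * σ.permMatrix ℂ) ((σ⁻¹).permMatrix ℂ)
    (mul_mem (diagonal_sign_mem_unitaryGroup e) (permMatrix_mem_unitaryGroup σ))
    (permMatrix_mem_unitaryGroup _)]
  congr 1
  ext i j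
  rw [Matrix.mul_assoc, Matrix.mul_assoc, Matrix.diagonal_mul, Equiv.Perm.permMatrix,
    PEquiv.toMatrix_toPEquiv_mul, Matrix.submatrix_apply, Matrix.diagonal_mul]
  by_cases h : i = j
  · subst h; simp [PEquiv.toMatrix_apply]
  · have : σ⁻¹ (σ i) ≠ j := by simpa using h
    simp [PEquiv.toMatrix_apply, h]

/-- A sublevel set of the norm is convex and contains every signed permutation of `d`, hence their
hull. No ordering of `d` is needed, so it may be the diagonal of a matrix in any basis. -/
theorem map_diagonal_le_of_sum_le (hN : IsSymmetricNorm N) (x d : Fin n → ℝ) (hx : Antitone x)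
    (hx0 : ∀ i, 0 ≤ x i)
    (h : ∀ k (hk : k ≤ n),
      ∑ i : Fin k, x (Fin.castLE hk i) ≤ ∑ i : Fin k, d (Fin.castLE hk i)) :
    N (Matrix.diagonal fun i => (x i : ℂ)) ≤ N (Matrix.diagonal fun i => (d i : ℂ)) := by
  have hconv : Convex ℝ {y : Fin n → ℝ | N (Matrix.diagonal fun i => (y i : ℂ)) ≤
      N (Matrix.diagonal fun i => (d i : ℂ))} := by
    intro y hy w hw a b ha hb hab
    simp only [Set.mem_ofPred_eq] at hy hw ⊢
    have e1 : (Matrix.diagonal fun i => (((a • y + b • w) i : ℝ) : ℂ)) =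
        (a : ℂ) • (Matrix.diagonal fun i => (y i : ℂ)) +
        (b : ℂ) • (Matrix.diagonal fun i => (w i : ℂ)) := by
      rw [← Matrix.diagonal_smul, ← Matrix.diagonal_smul, Matrix.diagonal_add]
      congr 1; ext i; simp
    rw [e1]
    refine (map_add_le_add N _ _).trans ?_
    rw [map_smul_eq_mul, map_smul_eq_mul, Complex.norm_of_nonneg ha, Complex.norm_of_nonneg hb]
    calc _ ≤ a * N (Matrix.diagonal fun i => (d i : ℂ)) +
          b * N (Matrix.diagonal fun i => (d i : ℂ)) := by gcongr
      _ = _ := by rw [← add_mul, hab, one_mul]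
  refine convexHull_min ?_ hconv (mem_convexHull_sign_perm x d hx hx0 h)
  rintro _ ⟨⟨e, σ⟩, rfl⟩
  exact (hN.map_diagonal_sign_perm d e σ).le

/-- Pinching: the diagonal part of a matrix does not exceed it in norm. -/
theorem map_diagonal_diag_le (hN : IsSymmetricNorm N) (R : Matrix (Fin n) (Fin n) ℂ) :
    N (Matrix.diagonal fun i => R i i) ≤ N R := by
  -- Averaging the conjugates by all sign matrices kills the off-diagonal entries.
  let D : (Fin n → ℤˣ) → Matrix (Fin n) (Fin n) ℂ := fun e =>
    Matrix.diagonal fun i => ((e i : ℤ) : ℂ)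
  have hsum : ∑ e, D e * R * D e =
      (Fintype.card (Fin n → ℤˣ) : ℂ) • Matrix.diagonal fun i => R i i := by
    ext i j
    simp only [Matrix.sum_apply, D, Matrix.mul_diagonal, Matrix.diagonal_mul, Matrix.smul_apply]
    by_cases hij : i = j
    · subst hij
      have : ∀ e : Fin n → ℤˣ, ((e i : ℤ) : ℂ) * R i i * ((e i : ℤ) : ℂ) = R i i := fun e => by
        rcases Int.units_eq_one_or (e i) with h | h <;> simp [h]
      simp [this]
    · rw [Matrix.diagonal_apply_ne _ hij, smul_zero,
        ← mul_zero (R i j), ← sum_sign_mul_sign hij, Finset.mul_sum]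
      exact Finset.sum_congr rfl fun e _ => by ring
  have hle : N (∑ e, D e * R * D e) ≤ ∑ e : Fin n → ℤˣ, N R := by
    refine (Finset.le_sum_of_subadditive N (map_zero N).le (map_add_le_add N) _ _).trans (Finset.sum_le_sum fun e _ => ?_)
    exact (hN.map_unitary_mul_mul_unitary R _ _ (diagonal_sign_mem_unitaryGroup e)
      (diagonal_sign_mem_unitaryGroup e)).le
  rw [hsum, map_smul_eq_mul, Finset.sum_const, nsmul_eq_mul, Complex.norm_natCast,
    Finset.card_univ] at hle
  exact le_of_mul_le_mul_left hle (by exact_mod_cast Fintype.card_pos)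

end IsSymmetricNorm

/-! ### Spectral decomposition, interlacing and log-majorization -/

section PositiveMatrices

open scoped ComplexOrder

namespace Matrix

/-- A sorted spectral decomposition of a positive semidefinite matrix, compatible with powers. -/
theorem PosSemidef.exists_antitone_diagonalization {n : ℕ} {H : Matrix (Fin n) (Fin n) ℂ}
    (hH : H.PosSemidef) :
    ∃ W ∈ unitaryGroup (Fin n) ℂ, ∃ a : Fin n → ℝ, Antitone a ∧ (∀ i, 0 ≤ a i) ∧
      H = W * diagonal (fun i => (a i : ℂ)) * Wᴴ ∧
      ∀ p : ℝ, H ^ p = W * diagonal (fun i => ((a i ^ p : ℝ) : ℂ)) * Wᴴ := by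
  let U : Matrix (Fin n) (Fin n) ℂ := hH.1.eigenvectorUnitary
  have hU : U ∈ unitaryGroup (Fin n) ℂ := hH.1.eigenvectorUnitary.2
  let σ : Equiv.Perm (Fin n) := Tuple.sort fun i => OrderDual.toDual (hH.1.eigenvalues i)
  have key : ∀ v : Fin n → ℂ, U * diagonal v * Uᴴ =
      U.submatrix id σ * diagonal (fun i => v (σ i)) * (U.submatrix id σ)ᴴ := by
    intro v
    ext i j
    simp only [mul_apply, diagonal, of_apply, conjTranspose_apply, submatrix_apply, id,
      mul_ite, mul_zero, Finset.sum_ite_eq', Finset.mem_univ, if_true]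
    exact (Equiv.sum_comp σ (fun k => U i k * v k * star (U j k))).symm
  refine ⟨U.submatrix id σ, ?_, fun i => hH.1.eigenvalues (σ i), fun i j hij =>
    Tuple.monotone_sort (fun i => OrderDual.toDual (hH.1.eigenvalues i)) hij,
    fun i => hH.eigenvalues_nonneg _, ?_, fun p => ?_⟩
  · rw [mem_unitaryGroup_iff, star_eq_conjTranspose]
    have := key fun _ => 1
    rw [diagonal_one, mul_one, mul_one] at this
    rw [← this]
    exact mem_unitaryGroup_iff.1 hU
  · rw [← key fun i => (hH.1.eigenvalues i : ℂ)]
    exact hH.1.spectral_theorem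
  · rw [← key fun i => ((hH.1.eigenvalues i ^ p : ℝ) : ℂ),
      CFC.rpow_eq_cfc_real (nonneg_iff_posSemidef.2 hH), hH.1.cfc_eq]
    rfl

/-- Interlacing for compressions. -/
theorem le_of_diagonal_le_compression {n k : ℕ} (hk : k ≤ n) (G : Matrix (Fin n) (Fin k) ℂ)
    (hG : Gᴴ * G = 1) (l : Fin n → ℝ) (t : Fin k → ℝ) (hl : Antitone l) (ht : Antitone t)
    (h : (Gᴴ * diagonal (fun i => (l i : ℂ)) * G - diagonal (fun i => (t i : ℂ))).PosSemidef)
    (i : Fin k) : t i ≤ l (Fin.castLE hk i) := by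
  -- A kernel vector `x` of `M` has (Gx)_r = 0 for r < i (rows above `i`) and x_r = 0 for r > i
  -- (rows below). The zero row `i` makes `M` singular, so such an `x` ≠ 0 exists; its two quadratic
  -- forms are then compared.
  let M : Matrix (Fin k) (Fin k) ℂ := of fun r m =>
    if r < i then G (Fin.castLE hk r) m else if r = i then 0 else (1 : Matrix _ _ ℂ) r m
  have hdet : M.det = 0 := det_eq_zero_of_row_eq_zero i fun m => by simp [M]
  obtain ⟨x, hx0, hx⟩ := exists_mulVec_eq_zero_iff.2 hdet
  have hxr : ∀ r, i < r → x r = 0 := by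
    intro r hr
    have := congrFun hx r
    simpa [M, mulVec, dotProduct, not_lt.2 hr.le, hr.ne', one_apply] using this
  have hy : ∀ j : Fin n, j < Fin.castLE hk i → (G *ᵥ x) j = 0 := by
    intro j hj
    have hji : (⟨j, lt_trans (Fin.lt_def.1 hj) i.2⟩ : Fin k) < i := hj
    have := congrFun hx ⟨j, lt_trans (Fin.lt_def.1 hj) i.2⟩
    simpa [M, mulVec, dotProduct, hji] using this
  set y := G *ᵥ x with hydef
  have hnorm : ∑ j, ‖y j‖ ^ 2 = ∑ r, ‖x r‖ ^ 2 := by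
    have e : star y ⬝ᵥ y = star x ⬝ᵥ x := by
      rw [hydef, star_mulVec, ← dotProduct_mulVec, mulVec_mulVec, hG, one_mulVec]
    have e2 : ∀ {m : ℕ} (v : Fin m → ℂ), star v ⬝ᵥ v = ((∑ j, ‖v j‖ ^ 2 : ℝ) : ℂ) := by
      intro m v
      simp [dotProduct, Complex.conj_mul']
    rw [e2, e2] at e
    exact_mod_cast e
  have hquad : ∑ r, t r * ‖x r‖ ^ 2 ≤ ∑ j, l j * ‖y j‖ ^ 2 := by
    have e2 : ∀ {m : ℕ} (d : Fin m → ℝ) (v : Fin m → ℂ),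
        star v ⬝ᵥ (diagonal (fun i => (d i : ℂ)) *ᵥ v) =
          ((∑ j, d j * ‖v j‖ ^ 2 : ℝ) : ℂ) := by
      intro m d v
      simp only [dotProduct, mulVec_diagonal, Pi.star_apply, RCLike.star_def, Complex.ofReal_sum,
        Complex.ofReal_mul, Complex.ofReal_pow]
      refine Finset.sum_congr rfl fun j _ => ?_
      rw [← Complex.conj_mul']
      ring
    have := h.dotProduct_mulVec_nonneg x
    rw [sub_mulVec, dotProduct_sub, ← mulVec_mulVec, ← mulVec_mulVec, ← hydef,
      dotProduct_mulVec, ← star_mulVec, ← hydef, e2, e2, sub_nonneg] at this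
    exact_mod_cast this
  have hpos : 0 < ∑ r, ‖x r‖ ^ 2 := by
    obtain ⟨r, hr⟩ := Function.ne_iff.1 hx0
    exact Finset.sum_pos' (fun _ _ => by positivity) ⟨r, Finset.mem_univ _, by
      have : 0 < ‖x r‖ := norm_pos_iff.2 hr
      positivity⟩
  have h1 : t i * ∑ r, ‖x r‖ ^ 2 ≤ ∑ r, t r * ‖x r‖ ^ 2 := by
    rw [Finset.mul_sum]
    refine Finset.sum_le_sum fun r _ => ?_
    rcases le_or_gt r i with hr | hr
    · exact mul_le_mul_of_nonneg_right (ht hr) (by positivity)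
    · simp [hxr r hr]
  have h2 : ∑ j, l j * ‖y j‖ ^ 2 ≤ l (Fin.castLE hk i) * ∑ j, ‖y j‖ ^ 2 := by
    rw [Finset.mul_sum]
    refine Finset.sum_le_sum fun j _ => ?_
    rcases lt_or_ge j (Fin.castLE hk i) with hj | hj
    · simp [hy j hj]
    · exact mul_le_mul_of_nonneg_right (hl hj) (by positivity)
  rw [hnorm] at h2
  exact le_of_mul_le_mul_right (h1.trans (hquad.trans h2)) hpos

/-- Diagonalizing `R` by `F` makes Eᴴ U F an isometry, so interlacing bounds each eigenvalue of `R`;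
multiply these bounds. -/
theorem det_re_le_prod_of_le_compression {n k : ℕ} (hk : k ≤ n) {E : Matrix (Fin n) (Fin n) ℂ}
    (hE : E ∈ unitaryGroup (Fin n) ℂ) {l : Fin n → ℝ} (hl : Antitone l)
    {U : Matrix (Fin n) (Fin k) ℂ} (hU : Uᴴ * U = 1) {R : Matrix (Fin k) (Fin k) ℂ}
    (hR : R.PosSemidef)
    (h : (Uᴴ * (E * diagonal (fun i => (l i : ℂ)) * Eᴴ) * U - R).PosSemidef) :
    R.det.re ≤ ∏ i : Fin k, l (Fin.castLE hk i) := by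
  obtain ⟨F, hF, t, ht, ht0, hRF, -⟩ := hR.exists_antitone_diagonalization
  have hF1 : F * Fᴴ = 1 := mem_unitaryGroup_iff.1 hF
  have hF2 : Fᴴ * F = 1 := mem_unitaryGroup_iff'.1 hF
  have hE1 : E * Eᴴ = 1 := mem_unitaryGroup_iff.1 hE
  have hdet : R.det = ((∏ i, t i : ℝ) : ℂ) := by
    rw [hRF, det_mul_right_comm, hF1, one_mul, det_diagonal]
    simp
  have hG : (Eᴴ * U * F)ᴴ * (Eᴴ * U * F) = 1 := by
    simp only [conjTranspose_mul, conjTranspose_conjTranspose]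
    calc Fᴴ * (Uᴴ * E) * (Eᴴ * U * F) = Fᴴ * (Uᴴ * (E * Eᴴ) * U) * F := by
          simp only [Matrix.mul_assoc]
      _ = 1 := by rw [hE1, Matrix.mul_one, hU, Matrix.mul_one, hF2]
  have hle := le_of_diagonal_le_compression hk (Eᴴ * U * F) hG l t hl ht (by
    have := h.conjTranspose_mul_mul_same F
    convert this using 1
    rw [hRF, Matrix.mul_sub, Matrix.sub_mul]
    congr 1
    · simp only [conjTranspose_mul, conjTranspose_conjTranspose, Matrix.mul_assoc]
    · calc _ = (Fᴴ * F) * diagonal (fun i => (t i : ℂ)) * (Fᴴ * F) := by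
            rw [hF2, one_mul, mul_one]
        _ = _ := by simp only [Matrix.mul_assoc])
  rw [hdet, Complex.ofReal_re]
  exact Finset.prod_le_prod (fun i _ => ht0 i) fun i _ => hle i

/-- Weak log-majorization for the off-diagonal part of a positive block matrix. -/
theorem prod_singular_le_prod_of_fromBlocks_posSemidef {n k : ℕ} (hk : k ≤ n)
    {S X E W : Matrix (Fin n) (Fin n) ℂ} (hS : S.PosDef)
    (hB : (fromBlocks S Xᴴ X S).PosSemidef)
    (hE : E ∈ unitaryGroup (Fin n) ℂ) {l : Fin n → ℝ} (hl : Antitone l)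
    (hSE : S = E * diagonal (fun i => (l i : ℂ)) * Eᴴ)
    (hW : W ∈ unitaryGroup (Fin n) ℂ) {s : Fin n → ℝ}
    (hXW : Xᴴ * X = W * diagonal (fun i => ((s i ^ 2 : ℝ) : ℂ)) * Wᴴ)
    (hs : ∀ i : Fin k, 0 < s (Fin.castLE hk i)) (hl0 : ∀ i, 0 ≤ l i) :
    ∏ i : Fin k, s (Fin.castLE hk i) ≤ ∏ i : Fin k, l (Fin.castLE hk i) := by
  have hW2 : Wᴴ * W = 1 := mem_unitaryGroup_iff'.1 hW
  let c : Fin k → Fin n := Fin.castLE hk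
  have hc : Function.Injective c := Fin.castLE_injective hk
  -- `U` and `V` below hold the right and left singular vectors of `X` for its first `k` singular
  -- values, which form `D`.
  let U : Matrix (Fin n) (Fin k) ℂ := W.submatrix id c
  let D : Matrix (Fin k) (Fin k) ℂ := diagonal fun i => (s (c i) : ℂ)
  let D' : Matrix (Fin k) (Fin k) ℂ := diagonal fun i => ((s (c i) : ℂ))⁻¹
  have hs0 : ∀ i, (s (c i) : ℂ) ≠ 0 := fun i => by exact_mod_cast (hs i).ne'
  have hDD' : D' * D = 1 := by
    simp [D, D', diagonal_mul_diagonal, hs0]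
  have hDD : D * D' = 1 := by
    simp [D, D', diagonal_mul_diagonal, hs0]
  have hDh : Dᴴ = D := by
    simp [D, diagonal_conjTranspose, Pi.star_def]
  have hDh' : D'ᴴ = D' := by
    simp [D', diagonal_conjTranspose, Pi.star_def]
  have hWU : Wᴴ * U = (1 : Matrix (Fin n) (Fin n) ℂ).submatrix id c := by
    rw [← hW2]; rfl
  have hUW : Uᴴ * W = (1 : Matrix (Fin n) (Fin n) ℂ).submatrix c id := by
    rw [← hW2]; rfl
  have hU : Uᴴ * U = 1 := by
    have : Uᴴ * U = (Wᴴ * W).submatrix c c := rfl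
    rw [this, hW2, submatrix_one _ hc]
  have hXU : Uᴴ * (Xᴴ * X) * U = D * D := by
    rw [hXW]
    calc _ = (Uᴴ * W) * diagonal (fun i => ((s i ^ 2 : ℝ) : ℂ)) * (Wᴴ * U) := by
          simp only [Matrix.mul_assoc]
      _ = D * D := by
          rw [hWU, hUW]
          ext i j
          simp only [D, mul_apply, submatrix_apply, id, diagonal, of_apply, one_apply]
          simp only [pow_two, hc.eq_iff, ite_mul, mul_ite, mul_one, mul_zero, one_mul, zero_mul,
            Finset.sum_ite_eq', Finset.mem_univ, if_true, Complex.ofReal_mul]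
          split_ifs with hij
          · rw [hij]
          · rfl
  let V : Matrix (Fin n) (Fin k) ℂ := X * U * D'
  have hVh : Vᴴ = D' * (Uᴴ * Xᴴ) := by
    simp only [V, conjTranspose_mul, hDh']
  have hVX : Vᴴ * X * U = D := by
    calc Vᴴ * X * U = D' * (Uᴴ * (Xᴴ * X) * U) := by rw [hVh]; simp only [Matrix.mul_assoc]
      _ = D := by rw [hXU, ← Matrix.mul_assoc, hDD', one_mul]
  have hV : Vᴴ * V = 1 := by
    calc Vᴴ * V = Vᴴ * X * U * D' := by simp only [V, Matrix.mul_assoc]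
      _ = 1 := by rw [hVX, hDD]
  have hXV : Uᴴ * Xᴴ * V = Dᴴ := by
    rw [← hVX]; simp only [conjTranspose_mul, conjTranspose_conjTranspose, Matrix.mul_assoc]
  have hP : (Uᴴ * S * U).PosDef := hS.conjTranspose_mul_mul_same (by
    intro v w hvw
    have := congrArg (fun z => Uᴴ *ᵥ z) hvw
    simpa [mulVec_mulVec, hU] using this)
  have hblock : (fromBlocks (Uᴴ * S * U) D Dᴴ (Vᴴ * S * V)).PosSemidef := by
    have := hB.conjTranspose_mul_mul_same (fromBlocks U 0 0 V)
    convert this using 1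
    simp only [fromBlocks_conjTranspose, fromBlocks_multiply, conjTranspose_zero, Matrix.zero_mul,
      Matrix.mul_zero, add_zero, zero_add]
    rw [hVX, hXV, hDh]
  have := hP.isUnit.invertible
  -- With P = Uᴴ S U, the Schur complement gives D P⁻¹ D ≤ Vᴴ S V. Both det P and det (D P⁻¹ D) are
  -- at most ∏ l, and their product is (det D)².
  have hSchur := (PosDef.fromBlocks₁₁ D (Vᴴ * S * V) hP).1 hblock
  have h1 := det_re_le_prod_of_le_compression hk hE hl hU hP.posSemidef (by
    rw [← hSE, sub_self]; exact PosSemidef.zero)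
  have h2 := det_re_le_prod_of_le_compression hk hE hl hV
    (hP.inv.posSemidef.conjTranspose_mul_mul_same D) (by rwa [← hSE])
  have hdP := hP.det_pos
  have hdD : D.det = ((∏ i, s (c i) : ℝ) : ℂ) := by simp [D, det_diagonal]
  have hdP' : (Uᴴ * S * U).det = ((Uᴴ * S * U).det.re : ℂ) := by
    apply Complex.ext
    · simp
    · simpa using ((Complex.lt_def.1 hdP).2).symm
  have hprod : (∏ i, s (c i)) * (∏ i, s (c i)) =
      (Uᴴ * S * U).det.re * (Dᴴ * (Uᴴ * S * U)⁻¹ * D).det.re := by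
    have : D.det * D.det = (Uᴴ * S * U).det * (Dᴴ * (Uᴴ * S * U)⁻¹ * D).det := by
      rw [det_mul, det_mul, hDh, det_nonsing_inv, Ring.inverse_eq_inv']
      field_simp [hdP.ne']
    rw [hdP', hdD] at this
    have h3 := congrArg Complex.re this
    rwa [Complex.re_ofReal_mul, Complex.re_ofReal_mul, Complex.ofReal_re] at h3
  have hpl : 0 ≤ ∏ i : Fin k, l (Fin.castLE hk i) := Finset.prod_nonneg fun i _ => hl0 _
  have hps : 0 ≤ ∏ i : Fin k, s (Fin.castLE hk i) := Finset.prod_nonneg fun i _ => (hs i).le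
  refine (mul_self_le_mul_self_iff hps hpl).2 ?_
  rw [hprod]
  exact mul_le_mul h1 h2
    (Complex.le_def.1 (hP.inv.posSemidef.conjTranspose_mul_mul_same D).det_nonneg).1 hpl

end Matrix

end PositiveMatrices

/-! ### Power inequalities in C⋆-algebras -/

section CStarAlgebra

variable {A : Type*} [CStarAlgebra A] [PartialOrder A] [StarOrderedRing A]

theorem CFC.rpow_half_mul_rpow_half {a : A} (ha : IsStrictlyPositive a) :
    a ^ (1 / 2 : ℝ) * a ^ (1 / 2 : ℝ) = a := by
  rw [← CFC.rpow_add ha.isUnit, add_halves, CFC.rpow_one a ha.nonneg]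

/-- Löwner–Heinz for the exponent 1 - p followed by inversion gives c^(p-1) ≤ a^(p-1); conjugate by
a^(1/2). -/
theorem CFC.conjugate_rpow_sub_one_le_rpow {a c : A} (ha : IsStrictlyPositive a) (hac : a ≤ c)
    {p : ℝ} (hp0 : 0 ≤ p) (hp1 : p ≤ 1) :
    a ^ (1 / 2 : ℝ) * c ^ (p - 1) * a ^ (1 / 2 : ℝ) ≤ a ^ p := by
  have hc : IsStrictlyPositive c := ha.of_le hac
  rcases hp1.eq_or_lt with rfl | hp
  · rw [sub_self, CFC.rpow_zero c hc.nonneg, mul_one, CFC.rpow_half_mul_rpow_half ha,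
      CFC.rpow_one a ha.nonneg]
  · have h1 : a ^ (1 - p) ≤ c ^ (1 - p) :=
      CFC.rpow_le_rpow ⟨by linarith, by linarith⟩ hac
    have h2 := CStarAlgebra.rpow_neg_one_le_rpow_neg_one h1 (IsStrictlyPositive.rpow a _ ha)
    rw [CFC.rpow_rpow a _ _ (by linarith) ha, CFC.rpow_rpow c _ _ (by linarith) hc] at h2
    have e : (1 - p) * -1 = p - 1 := by ring
    rw [e] at h2
    have h3 := IsSelfAdjoint.conjugate_le_conjugate h2
      (IsSelfAdjoint.of_nonneg (CFC.rpow_nonneg (a := a) (y := 1 / 2)))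
    refine h3.trans_eq ?_
    rw [← CFC.rpow_add ha.isUnit, ← CFC.rpow_add ha.isUnit]
    congr 1
    ring

theorem CFC.add_algebraMap_rpow_le {a : A} (ha : 0 ≤ a) {e : ℝ} (he : 0 < e) {p : ℝ}
    (hp0 : 0 < p) (hp1 : p ≤ 1) :
    (a + algebraMap ℝ A e) ^ p ≤ a ^ p + algebraMap ℝ A (e ^ p) := by
  have hspec : ∀ x ∈ spectrum ℝ a, 0 ≤ x := fun x hx => spectrum_nonneg_of_nonneg ha hx
  have hc : ContinuousOn (fun x : ℝ => x ^ p) (spectrum ℝ a) :=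
    (Real.continuous_rpow_const hp0.le).continuousOn
  have h1 : a + algebraMap ℝ A e = cfc (fun x : ℝ => x + e) a := by
    rw [cfc_add_const e (fun x => x) a, cfc_id' ℝ a]
  have h2 : a ^ p + algebraMap ℝ A (e ^ p) = cfc (fun x : ℝ => x ^ p + e ^ p) a := by
    rw [cfc_add_const (e ^ p) (fun x => x ^ p) a, CFC.rpow_eq_cfc_real ha]
  have hc2 : Continuous (fun x : ℝ => (x + e) ^ p) :=
    (Real.continuous_rpow_const hp0.le).comp (continuous_id.add continuous_const)
  rw [h1, h2, CFC.cfc_rpow (fun x hx => by linarith [hspec x hx])]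
  refine cfc_mono (fun x hx => Real.rpow_add_le_add_rpow (hspec x hx) he.le hp0.le hp1)
    hc2.continuousOn (hc.add continuousOn_const)

end CStarAlgebra

/-! ### Subadditivity of powers on diagonals -/

/-- Terms with both indices below `k` cancel by antisymmetry; the others have j ≥ k > i and are
nonnegative. -/
theorem sum_sum_mul_sub_nonneg_of_monotone {n : ℕ} (m : Fin n → Fin n → ℝ)
    (hm : ∀ i j, m i j = m j i) (hm0 : ∀ i j, 0 ≤ m i j) (g : Fin n → ℝ) (hg : Monotone g)
    (k : ℕ) (hk : k ≤ n) :
    0 ≤ ∑ i : Fin k, ∑ j, m (Fin.castLE hk i) j * (g j - g (Fin.castLE hk i)) := by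
  set c : Fin k → Fin n := Fin.castLE hk
  have h0 : ∑ i : Fin k, ∑ j : Fin k, m (c i) (c j) * (g (c j) - g (c i)) = 0 := by
    have h := Finset.sum_comm (s := Finset.univ) (t := Finset.univ)
      (f := fun i j : Fin k => m (c i) (c j) * (g (c j) - g (c i)))
    have h' : ∑ j : Fin k, ∑ i : Fin k, m (c i) (c j) * (g (c j) - g (c i)) =
        -∑ i : Fin k, ∑ j : Fin k, m (c i) (c j) * (g (c j) - g (c i)) := by
      rw [← Finset.sum_neg_distrib]
      refine Finset.sum_congr rfl fun j _ => ?_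
      rw [← Finset.sum_neg_distrib]
      refine Finset.sum_congr rfl fun i _ => ?_
      rw [hm]
      ring
    linarith
  rw [← h0]
  refine Finset.sum_le_sum fun i _ => ?_
  have := Finset.sum_map Finset.univ (Fin.castLEEmb hk)
    (fun j => m (c i) j * (g j - g (c i)))
  refine le_of_eq_of_le this.symm (Finset.sum_le_sum_of_subset_of_nonneg (Finset.subset_univ _) ?_)
  intro j _ hj
  refine mul_nonneg (hm0 _ _) (sub_nonneg.2 (hg ?_))
  by_contra hlt
  have hjk : j.val < k := lt_trans (Fin.lt_def.1 (not_le.1 hlt)) i.2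
  exact hj (Finset.mem_map.2 ⟨⟨j, hjk⟩, Finset.mem_univ _, rfl⟩)

section PositiveMatrices

open scoped ComplexOrder

namespace Matrix

variable {n : ℕ}

/-- Both sides are sums weighted by |H i j|², and their difference is the double sum of
`sum_sum_mul_sub_nonneg_of_monotone`. -/
theorem IsHermitian.sum_mul_diag_sq_le {H : Matrix (Fin n) (Fin n) ℂ} (hH : H.IsHermitian)
    (g : Fin n → ℝ) (hg : Monotone g) (k : ℕ) (hk : k ≤ n) :
    ∑ i : Fin k, g (Fin.castLE hk i) * ((H * H) (Fin.castLE hk i) (Fin.castLE hk i)).re ≤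
      ∑ i : Fin k, ((H * diagonal (fun j => (g j : ℂ)) * H)
        (Fin.castLE hk i) (Fin.castLE hk i)).re := by
  have hstar : ∀ i j, H j i = star (H i j) := fun i j => (hH.apply j i).symm
  have hn : ∀ i j, H i j * H j i = ((‖H i j‖ ^ 2 : ℝ) : ℂ) := fun i j => by
    rw [hstar i j, RCLike.star_def, Complex.mul_conj']
    simp
  have h := sum_sum_mul_sub_nonneg_of_monotone (fun i j => ‖H i j‖ ^ 2)
    (fun i j => by rw [hstar i j, norm_star]) (fun _ _ => by positivity) g hg k hk
  have e1 : ∀ i, ((H * H) i i).re = ∑ j, ‖H i j‖ ^ 2 := fun i => by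
    simp only [mul_apply, hn, Complex.re_sum, Complex.ofReal_re]
  have e2 : ∀ i, ((H * diagonal (fun j => (g j : ℂ)) * H) i i).re =
      ∑ j, ‖H i j‖ ^ 2 * g j := fun i => by
    rw [mul_apply, Complex.re_sum]
    refine Finset.sum_congr rfl fun j _ => ?_
    rw [mul_diagonal, mul_right_comm, hn, ← Complex.ofReal_mul, Complex.ofReal_re]
  simp only [e1, e2]
  simp only [mul_sub, Finset.sum_sub_distrib, ← Finset.sum_mul] at h
  have e3 : ∀ i, g i * ∑ j, ‖H i j‖ ^ 2 = (∑ j, ‖H i j‖ ^ 2) * g i := fun i => mul_comm _ _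
  simp only [e3]
  linarith

theorem diag_conjugate_re_mono {P Q : Matrix (Fin n) (Fin n) ℂ} (h : P ≤ Q)
    (E : Matrix (Fin n) (Fin n) ℂ) (i : Fin n) :
    ((Eᴴ * P * E) i i).re ≤ ((Eᴴ * Q * E) i i).re := by
  have h1 := ((le_iff.1 h).conjTranspose_mul_mul_same E).diag_nonneg (i := i)
  rw [Matrix.mul_sub, Matrix.sub_mul, sub_apply, sub_nonneg] at h1
  exact (Complex.le_def.1 h1).1

-- Take H = Eᴴ A^(1/2) E and the weights c^(p-1), which increase along the index since p ≤ 1. Then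
-- H² = Eᴴ A E, and inserting the weights gives Eᴴ A^(1/2) C^(p-1) A^(1/2) E, at most Eᴴ A^p E.
open scoped Matrix.Norms.L2Operator in
theorem PosDef.sum_rpow_sub_one_mul_diag_le {A C E : Matrix (Fin n) (Fin n) ℂ} (hA : A.PosDef)
    (hAC : A ≤ C) (hE : E ∈ unitaryGroup (Fin n) ℂ) {c : Fin n → ℝ} (hc : Antitone c)
    (hc0 : ∀ i, 0 < c i) {p : ℝ} (hp0 : 0 ≤ p) (hp1 : p ≤ 1)
    (hCE : C ^ (p - 1) = E * diagonal (fun i => ((c i ^ (p - 1) : ℝ) : ℂ)) * Eᴴ)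
    (k : ℕ) (hk : k ≤ n) :
    ∑ i : Fin k, c (Fin.castLE hk i) ^ (p - 1) *
        ((Eᴴ * A * E) (Fin.castLE hk i) (Fin.castLE hk i)).re ≤
      ∑ i : Fin k, ((Eᴴ * A ^ p * E) (Fin.castLE hk i) (Fin.castLE hk i)).re := by
  have hE1 : E * Eᴴ = 1 := mem_unitaryGroup_iff.1 hE
  have hsA := hA.isStrictlyPositive
  have hAh : (A ^ (1 / 2 : ℝ)).IsHermitian :=
    (nonneg_iff_posSemidef.1 (CFC.rpow_nonneg (a := A) (y := 1 / 2))).1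
  have hH : (Eᴴ * A ^ (1 / 2 : ℝ) * E).IsHermitian := isHermitian_conjTranspose_mul_mul E hAh
  have h := hH.sum_mul_diag_sq_le (fun i => c i ^ (p - 1)) (fun i j hij =>
    Real.rpow_le_rpow_of_nonpos (hc0 j) (hc hij) (by linarith)) k hk
  have e1 : Eᴴ * A ^ (1 / 2 : ℝ) * E * (Eᴴ * A ^ (1 / 2 : ℝ) * E) = Eᴴ * A * E := by
    calc _ = Eᴴ * A ^ (1 / 2 : ℝ) * (E * Eᴴ) * A ^ (1 / 2 : ℝ) * E := by
          simp only [Matrix.mul_assoc]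
      _ = Eᴴ * (A ^ (1 / 2 : ℝ) * A ^ (1 / 2 : ℝ)) * E := by
          rw [hE1, Matrix.mul_one]; simp only [Matrix.mul_assoc]
      _ = _ := by rw [CFC.rpow_half_mul_rpow_half hsA]
  have e2 : Eᴴ * A ^ (1 / 2 : ℝ) * E * diagonal (fun i => ((c i ^ (p - 1) : ℝ) : ℂ)) *
      (Eᴴ * A ^ (1 / 2 : ℝ) * E) =
      Eᴴ * (A ^ (1 / 2 : ℝ) * C ^ (p - 1) * A ^ (1 / 2 : ℝ)) * E := by
    rw [hCE]; simp only [Matrix.mul_assoc]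
  rw [e1, e2] at h
  exact h.trans (Finset.sum_le_sum fun i _ => diag_conjugate_re_mono
    (CFC.conjugate_rpow_sub_one_le_rpow hsA hAC hp0 hp1) E _)

/-- Subadditivity of powers of positive matrices, for partial sums of the diagonal in a sorted
eigenbasis of the sum. -/
theorem PosDef.sum_rpow_le_sum_diag_rpow_add_rpow {A B E : Matrix (Fin n) (Fin n) ℂ}
    (hA : A.PosDef) (hB : B.PosDef) (hE : E ∈ unitaryGroup (Fin n) ℂ) {c : Fin n → ℝ}
    (hc : Antitone c) (hc0 : ∀ i, 0 < c i)
    (hCE : A + B = E * diagonal (fun i => (c i : ℂ)) * Eᴴ)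
    (hCp : ∀ p : ℝ, (A + B) ^ p = E * diagonal (fun i => ((c i ^ p : ℝ) : ℂ)) * Eᴴ)
    {p : ℝ} (hp0 : 0 ≤ p) (hp1 : p ≤ 1) (k : ℕ) (hk : k ≤ n) :
    ∑ i : Fin k, c (Fin.castLE hk i) ^ p ≤
      ∑ i : Fin k, ((Eᴴ * (A ^ p + B ^ p) * E) (Fin.castLE hk i) (Fin.castLE hk i)).re := by
  have hE2 : Eᴴ * E = 1 := mem_unitaryGroup_iff'.1 hE
  have h1 := hA.sum_rpow_sub_one_mul_diag_le
    (le_add_of_nonneg_right (nonneg_iff_posSemidef.2 hB.posSemidef)) hE hc hc0 hp0 hp1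
    (hCp _) k hk
  have h2 := hB.sum_rpow_sub_one_mul_diag_le
    (le_add_of_nonneg_left (nonneg_iff_posSemidef.2 hA.posSemidef)) hE hc hc0 hp0 hp1
    (hCp _) k hk
  have hd : Eᴴ * (A + B) * E = diagonal (fun i => (c i : ℂ)) := by
    rw [hCE]
    calc _ = (Eᴴ * E) * diagonal (fun i => (c i : ℂ)) * (Eᴴ * E) := by
          simp only [Matrix.mul_assoc]
      _ = _ := by rw [hE2, one_mul, mul_one]
  have e : ∀ i, c i ^ p = c i ^ (p - 1) * ((Eᴴ * A * E) i i).re +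
      c i ^ (p - 1) * ((Eᴴ * B * E) i i).re := by
    intro i
    have := congrArg Complex.re (congrFun (congrFun hd i) i)
    rw [Matrix.mul_add, Matrix.add_mul, add_apply, Complex.add_re, diagonal_apply_eq,
      Complex.ofReal_re] at this
    rw [← mul_add, this, ← Real.rpow_add_one (hc0 i).ne']
    congr 1
    ring
  simp only [e, Finset.sum_add_distrib, Matrix.mul_add, Matrix.add_mul, add_apply, Complex.add_re]
  exact add_le_add h1 h2

/-! ### Normal matrices and the perturbed majorization -/

/-- For normal `A`, the block matrix with diagonal blocks `|A| + e` and off-diagonal blocks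
`Aᴴ`, `A` is positive semidefinite. -/
theorem fromBlocks_abs_add_posSemidef {A : Matrix (Fin n) (Fin n) ℂ} (hA : IsStarNormal A)
    {e : ℝ} (he : 0 < e) :
    (CFC.abs A + algebraMap ℝ _ e).PosDef ∧
    (fromBlocks (CFC.abs A + algebraMap ℝ _ e) Aᴴ A (CFC.abs A + algebraMap ℝ _ e)).PosSemidef := by
  set a := CFC.abs A
  have ha : a.PosSemidef := nonneg_iff_posSemidef.1 (CFC.abs_nonneg A)
  have hE : (algebraMap ℝ (Matrix (Fin n) (Fin n) ℂ) e).PosDef := by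
    rw [Algebra.algebraMap_eq_smul_one]
    exact PosDef.one.smul he
  set R := a + algebraMap ℝ (Matrix (Fin n) (Fin n) ℂ) e with hR
  have hRp : R.PosDef := hE.posSemidef_add ha
  refine ⟨hRp, ?_⟩
  have := hRp.isUnit.invertible
  have hblock := PosDef.fromBlocks₁₁ Aᴴ R hRp
  rw [conjTranspose_conjTranspose] at hblock
  rw [hblock]
  have haa : a * a = A * Aᴴ := by
    rw [CFC.abs_mul_abs]
    exact hA.star_comm_self
  have hcomm : Commute R A :=
    (CFC.commute_abs_self A).add_left (Algebra.commute_algebraMap_left _ _)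
  have hRinv : R⁻¹ * R = 1 := nonsing_inv_mul R ((isUnit_iff_isUnit_det R).1 hRp.isUnit)
  have hRinv' : R * R⁻¹ = 1 := mul_nonsing_inv R ((isUnit_iff_isUnit_det R).1 hRp.isUnit)
  have hARinv : A * R⁻¹ = R⁻¹ * A := by
    calc A * R⁻¹ = R⁻¹ * (R * A) * R⁻¹ := by
          rw [← Matrix.mul_assoc, hRinv, one_mul]
      _ = R⁻¹ * A * (R * R⁻¹) := by rw [hcomm.eq]; simp only [Matrix.mul_assoc]
      _ = _ := by rw [hRinv', mul_one]
  -- Normality gives A Aᴴ = a² and lets `A` commute with R⁻¹, so the Schur complement is R⁻¹(R² -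
  -- a²); the factor R R⁻¹ makes it a congruence of a positive matrix.
  have hkey : R - A * R⁻¹ * Aᴴ = R⁻¹ᴴ * (e • (R * R + a * a + e • a)) * R⁻¹ := by
    have h1 : (R * R - a * a) * R = e • (R * R + a * a + e • a) := by
      rw [hR, Algebra.algebraMap_eq_smul_one]
      simp only [Matrix.add_mul, Matrix.mul_add, Matrix.sub_mul, smul_mul_assoc, mul_smul_comm,
        one_mul, mul_one, smul_add, smul_sub]
      module
    rw [hRp.inv.1.eq, ← h1, haa, hARinv]
    calc R - R⁻¹ * A * Aᴴ = R⁻¹ * (R * R - A * Aᴴ) := by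
          rw [Matrix.mul_sub, ← Matrix.mul_assoc, hRinv, one_mul, Matrix.mul_assoc]
      _ = R⁻¹ * (R * R - A * Aᴴ) * (R * R⁻¹) := by rw [hRinv', mul_one]
      _ = _ := by simp only [Matrix.mul_assoc]
  rw [hkey]
  refine PosSemidef.conjTranspose_mul_mul_same ?_ _
  have hsq : ∀ {P : Matrix (Fin n) (Fin n) ℂ}, P.IsHermitian → (P * P).PosSemidef := fun {P} hP => by
    have := posSemidef_conjTranspose_mul_self P
    rwa [hP.eq] at this
  exact (((hsq hRp.1).add (hsq ha.1)).add (ha.smul he.le)).smul he.le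

open scoped Matrix.Norms.L2Operator in
/-- The main majorization, after a perturbation making everything invertible. -/
theorem exists_sum_singular_rpow_le {A B W : Matrix (Fin n) (Fin n) ℂ} (hA : IsStarNormal A)
    (hB : IsStarNormal B) (hW : W ∈ unitaryGroup (Fin n) ℂ) {s : Fin n → ℝ} (hs : Antitone s)
    (hs0 : ∀ i, 0 ≤ s i)
    (hXW : CFC.abs (A + B) = W * diagonal (fun i => (s i : ℂ)) * Wᴴ)
    {p : ℝ} (hp0 : 0 < p) (hp1 : p ≤ 1) {e : ℝ} (he : 0 < e) :
    ∃ E ∈ unitaryGroup (Fin n) ℂ, ∀ k (hk : k ≤ n),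
      ∑ i : Fin k, s (Fin.castLE hk i) ^ p ≤ ∑ i : Fin k,
        (((Eᴴ * (CFC.abs A ^ p + CFC.abs B ^ p) * E)
          (Fin.castLE hk i) (Fin.castLE hk i)).re + 2 * e ^ p) := by
  obtain ⟨hA', hAB⟩ := fromBlocks_abs_add_posSemidef hA he
  obtain ⟨hB', hBB⟩ := fromBlocks_abs_add_posSemidef hB he
  have hAp := CFC.add_algebraMap_rpow_le (CFC.abs_nonneg A) he hp0 hp1
  have hBp := CFC.add_algebraMap_rpow_le (CFC.abs_nonneg B) he hp0 hp1
  set A' := CFC.abs A + algebraMap ℝ (Matrix (Fin n) (Fin n) ℂ) e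
  set B' := CFC.abs B + algebraMap ℝ (Matrix (Fin n) (Fin n) ℂ) e
  have hS : (A' + B').PosDef := hA'.add hB'
  obtain ⟨E, hE, l, hl, hl0, hSE, hSp⟩ := hS.posSemidef.exists_antitone_diagonalization
  have hE2 : Eᴴ * E = 1 := mem_unitaryGroup_iff'.1 hE
  have hW2 : Wᴴ * W = 1 := mem_unitaryGroup_iff'.1 hW
  have hlpos : ∀ i, 0 < l i := by
    have hd : (diagonal fun i => (l i : ℂ)).PosDef := by
      have := hS
      rw [hSE] at this
      exact (IsUnit.posDef_star_right_conjugate_iff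
        (IsUnit.of_mul_eq_one Eᴴ (mem_unitaryGroup_iff.1 hE))).1 this
    intro i
    have := posDef_diagonal_iff.1 hd i
    exact_mod_cast this
  have hX2 : (A + B)ᴴ * (A + B) = W * diagonal (fun i => ((s i ^ 2 : ℝ) : ℂ)) * Wᴴ := by
    have h1 : (A + B)ᴴ * (A + B) = CFC.abs (A + B) * CFC.abs (A + B) :=
      (CFC.abs_mul_abs (A + B)).symm
    rw [h1, hXW]
    calc _ = W * (diagonal (fun i => (s i : ℂ)) * (Wᴴ * W) * diagonal (fun i => (s i : ℂ))) *
          Wᴴ := by simp only [Matrix.mul_assoc]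
      _ = _ := by
          rw [hW2, mul_one, diagonal_mul_diagonal]
          simp only [pow_two, Complex.ofReal_mul]
  have hblock : (fromBlocks (A' + B') (A + B)ᴴ (A + B) (A' + B')).PosSemidef := by
    have := hAB.add hBB
    rwa [fromBlocks_add, ← conjTranspose_add] at this
  refine ⟨E, hE, fun k hk => ?_⟩
  have h1 := sum_rpow_le_sum_rpow_of_prod_le_prod s l hs hs0 hlpos
    (fun k hk hpos => prod_singular_le_prod_of_fromBlocks_posSemidef hk hS hblock hE hl hSE hW
      hX2 hpos hl0) hp0 k hk
  have h2 := hA'.sum_rpow_le_sum_diag_rpow_add_rpow hB' hE hl hlpos hSE hSp hp0.le hp1 k hk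
  refine h1.trans (h2.trans (Finset.sum_le_sum fun i _ => ?_))
  refine (diag_conjugate_re_mono (add_le_add hAp hBp) E _).trans_eq ?_
  have h3 : CFC.abs A ^ p + algebraMap ℝ (Matrix (Fin n) (Fin n) ℂ) (e ^ p) +
      (CFC.abs B ^ p + algebraMap ℝ (Matrix (Fin n) (Fin n) ℂ) (e ^ p)) =
      (CFC.abs A ^ p + CFC.abs B ^ p) + ((2 * e ^ p : ℝ) : ℂ) • 1 := by
    simp only [Algebra.algebraMap_eq_smul_one, Complex.coe_smul]
    module
  rw [h3, Matrix.mul_add, Matrix.add_mul, Matrix.mul_smul, Matrix.smul_mul, Matrix.mul_one, hE2]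
  simp

end Matrix

end PositiveMatrices

/-! ### Passage to norms and the limit -/

open scoped ComplexOrder in
/-- The perturbed inequality, with an error term vanishing with `e`. -/
theorem IsSymmetricNorm.map_abs_add_rpow_le_add {n : ℕ}
    {N : Seminorm ℂ (Matrix (Fin n) (Fin n) ℂ)} (hN : IsSymmetricNorm N)
    {A B : Matrix (Fin n) (Fin n) ℂ} (hA : IsStarNormal A) (hB : IsStarNormal B)
    {p : ℝ} (hp0 : 0 < p) (hp1 : p ≤ 1) {e : ℝ} (he : 0 < e) :
    N (CFC.abs (A + B) ^ p) ≤ N (CFC.abs A ^ p + CFC.abs B ^ p) + 2 * e ^ p * N 1 := by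
  obtain ⟨W, hW, s, hs, hs0, hX, hXp⟩ := (Matrix.nonneg_iff_posSemidef.1
    (CFC.abs_nonneg (A + B))).exists_antitone_diagonalization
  obtain ⟨E, hE, hle⟩ := Matrix.exists_sum_singular_rpow_le hA hB hW hs hs0 hX hp0 hp1 he
  set R := CFC.abs A ^ p + CFC.abs B ^ p
  have hR : (E.conjTranspose * R * E).IsHermitian := by
    refine Matrix.isHermitian_conjTranspose_mul_mul E ?_
    exact (Matrix.nonneg_iff_posSemidef.1 (add_nonneg CFC.rpow_nonneg CFC.rpow_nonneg)).1
  have hd : (Matrix.diagonal fun i => ((((E.conjTranspose * R * E) i i).re + 2 * e ^ p : ℝ) : ℂ)) =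
      (Matrix.diagonal fun i => (E.conjTranspose * R * E) i i) + ((2 * e ^ p : ℝ) : ℂ) • 1 := by
    rw [← Matrix.diagonal_one, ← Matrix.diagonal_smul, Matrix.diagonal_add]
    congr 1
    ext i
    have : (((E.conjTranspose * R * E) i i).re : ℂ) = (E.conjTranspose * R * E) i i :=
      hR.coe_re_apply_self i
    rw [Complex.ofReal_add, this]
    simp
  have hpos : 0 ≤ 2 * e ^ p := by positivity
  calc N (CFC.abs (A + B) ^ p) = N (Matrix.diagonal fun i => ((s i ^ p : ℝ) : ℂ)) := by
        rw [hXp p]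
        exact hN.map_unitary_mul_mul_unitary _ _ _ hW (Unitary.star_mem hW)
    _ ≤ N (Matrix.diagonal fun i =>
          ((((E.conjTranspose * R * E) i i).re + 2 * e ^ p : ℝ) : ℂ)) :=
        hN.map_diagonal_le_of_sum_le _ _
          (fun i j hij => Real.rpow_le_rpow (hs0 j) (hs hij) hp0.le)
          (fun i => Real.rpow_nonneg (hs0 i) p) hle
    _ ≤ N (Matrix.diagonal fun i => (E.conjTranspose * R * E) i i) +
          N (((2 * e ^ p : ℝ) : ℂ) • 1) := by
        rw [hd]; exact map_add_le_add N _ _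
    _ ≤ N (E.conjTranspose * R * E) + 2 * e ^ p * N 1 := by
        refine add_le_add (hN.map_diagonal_diag_le _) (le_of_eq ?_)
        rw [map_smul_eq_mul, Complex.norm_of_nonneg hpos]
    _ = N R + 2 * e ^ p * N 1 := by
        rw [← Matrix.star_eq_conjTranspose,
          hN.map_unitary_mul_mul_unitary R _ _ (Unitary.star_mem hE) hE]

/-- `CFC.abs X` is `|X| = (Xᴴ X)^(1/2)`, and `_ ^ p` is the real power of a positive semidefinite
matrix given by the functional calculus of `t ↦ t ^ p` on `[0, ∞)` (the constant `1` if `p = 0`). -/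
theorem corollary1p6 (n : ℕ) (A B : Matrix (Fin n) (Fin n) ℂ)
    (hA : IsStarNormal A) (hB : IsStarNormal B)
    (N : Seminorm ℂ (Matrix (Fin n) (Fin n) ℂ)) (hN : IsSymmetricNorm N)
    (p : ℝ) (hp0 : 0 ≤ p) (hp1 : p ≤ 1) :
    N (CFC.abs (A + B) ^ p) ≤ N (CFC.abs A ^ p + CFC.abs B ^ p) := by
  -- At p = 0 the two sides are N 1 and 2 N 1; the limit argument needs p > 0 so that e^p → 0.
  rcases hp0.eq_or_lt with rfl | hp
  · rw [CFC.rpow_zero _ (CFC.abs_nonneg _), CFC.rpow_zero _ (CFC.abs_nonneg _),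
      CFC.rpow_zero _ (CFC.abs_nonneg _), ← two_smul ℂ (1 : Matrix (Fin n) (Fin n) ℂ),
      map_smul_eq_mul, Complex.norm_two]
    linarith [apply_nonneg N (1 : Matrix (Fin n) (Fin n) ℂ)]
  · have hcont : Continuous fun e : ℝ =>
        N (CFC.abs A ^ p + CFC.abs B ^ p) + 2 * e ^ p * N 1 :=
      continuous_const.add ((continuous_const.mul (Real.continuous_rpow_const hp.le)).mul
        continuous_const)
    have hlim := (hcont.tendsto 0).mono_left (nhdsWithin_le_nhds (s := Set.Ioi 0))
    rw [Real.zero_rpow hp.ne', mul_zero, zero_mul, add_zero] at hlim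
    refine ge_of_tendsto hlim ?_
    filter_upwards [self_mem_nhdsWithin] with e he
    exact hN.map_abs_add_rpow_le_add hA hB hp hp1 he
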